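/- Let $(X,d)$ be a complete separable metric space, $k\ge 1$, let $h_1,\dots,h_k:X\to X$ be Lipschitz maps and let $p_1,\dots,p_k:X\to[0,1]$ satisfy $\sum_{i}p_i(x)=1$ for all $x\in X$. Assume that (a) the $p_i$ are bounded away from $0$: there is $\varepsilon>0$ with $p_i(x)\ge\varepsilon$ for all $i$ and $x$; (b) each $p_i$ satisfies the Dini condition: its modulus of continuity $\varphi_i(t)=\sup\{|p_i(x)-p_i(y)|: d(x,y)\le t\}$ satisfies $\int_0^\delta \varphi_i(t)\,\frac{dt}{t}<\infty$ for some $\delta>0$; (c) the system is contracting on average: there is $b>0$ such that $$\sum_{j=1}^k p_j(x)\log\frac{d(h_j(x),h_j(y))}{d(x,y)}<-b\qquad\text{for all } x\ne y \text{ in } X \quad(\log 0=-\infty).$$ Let $\nu$ be an invariant measure of the system, i.e. a Borel probability measure on $X$ with $\nu=\sum_i (h_i)_*(p_i\cdot\nu)$. For $x\in X$ let $p_x$ be the probability measure on $\Sigma=\{1,\dots,k\}^{\mathbb N}$ that gives the cylinder of all sequences beginning with $\omega_1,\dots,\omega_n$ the mass $\prod_{i=1}^n p_{\omega_i}\bigl(h_{\omega_{i-1}}\circ\dots\circ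 h_{\omega_1}(x)\bigr)$, and let $\mu_+=\int_X p_x\,d\nu(x)$. Then there is a unique measure $\mu$ on $\{1,\dots,k\}^{\mathbb Z}$ that is invariant under the two-sided left shift $(\tilde\sigma\omega)_i=\omega_{i+1}$ and whose marginal on the positive coordinates $(\omega_1,\omega_2,\dots)$ is $\mu_+$ (the natural extension of $\mu_+$), and $\tilde\sigma$ is ergodic with respect to $\mu$. -/

import Mathlib

open MeasureTheory ProbabilityTheory Set
open scoped ENNReal NNReal

/-- An iterated function system with place-dependent probabilities: maps `h 0, …, h (k-1)` of `X`
to itself and a probability vector field `(p 0, …, p (k-1))` on `X`. From the point `x` the system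
moves to `h i x` with probability `p i x`. -/
structure IFS (X : Type*) [MeasurableSpace X] (k : ℕ) where
  /-- the maps -/
  h : Fin k → X → X
  /-- the probabilities -/
  p : Fin k → X → ℝ
  measurable_h : ∀ i, Measurable (h i)
  measurable_p : ∀ i, Measurable (p i)
  p_nonneg : ∀ i x, 0 ≤ p i x
  sum_p : ∀ x, ∑ i, p i x = 1

/-- The modulus of continuity `t ↦ sup {|f x - f y| : d(x, y) ≤ t}`. -/
noncomputable def modulusOfContinuity {X : Type*} [MetricSpace X] (f : X → ℝ) (t : ℝ) : ℝ≥0∞ :=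
  ⨆ (x : X) (y : X) (_ : dist x y ≤ t), ENNReal.ofReal |f x - f y|

/-- The Dini condition: the modulus of continuity `φ` of `f` satisfies `∫_0^δ φ(t)/t dt < ∞` for
some `δ > 0`. -/
def DiniCondition {X : Type*} [MetricSpace X] (f : X → ℝ) : Prop :=
  ∃ δ : ℝ, 0 < δ ∧ ∫⁻ t in Ioo 0 δ, modulusOfContinuity f t / ENNReal.ofReal t < ∞

namespace IFS

/-- Contraction on average: `∑ j, p j x * log (d(h j x, h j y) / d(x, y)) < -b < 0` uniformly in
`x ≠ y`. The logarithm is the extended one, so that `log 0 = -∞`. -/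
def ContractingOnAverage {X : Type*} [MetricSpace X] [MeasurableSpace X] {k : ℕ}
    (S : IFS X k) : Prop :=
  ∃ b : ℝ, 0 < b ∧ ∀ x y : X, x ≠ y →
    ∑ j, (S.p j x : EReal) * ENNReal.log (edist (S.h j x) (S.h j y) / edist x y) < ((-b : ℝ) : EReal)

section

variable {X : Type*} [MeasurableSpace X] {k : ℕ} (S : IFS X k)

/-- The action on measures, `F(ν) = ∑ i, (h i)_* (p i · ν)`. -/
noncomputable def transfer (ν : Measure X) : Measure X :=
  ∑ i, (ν.withDensity fun x => ENNReal.ofReal (S.p i x)).map (S.h i)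

/-- `ν` is an invariant measure of the system: a probability measure with `F(ν) = ν`. -/
structure IsInvariantMeasure (ν : Measure X) : Prop where
  isProbabilityMeasure : IsProbabilityMeasure ν
  transfer_eq : S.transfer ν = ν

/-- The point `h_{a_n} ∘ ⋯ ∘ h_{a_1} (x)`; the letters of `a` are numbered from `0` here. -/
def orbit (a : ℕ → Fin k) (x : X) : ℕ → X
  | 0 => x
  | n + 1 => S.h (a n) (orbit a x n)

/-- The choice of a letter at the point `x`: the letter `i` has probability `p i x`. -/
noncomputable def letterKernel : Kernel X (Fin k) where
  toFun x := ∑ i, ENNReal.ofReal (S.p i x) • Measure.dirac i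
  measurable' := by
    refine Measure.measurable_of_measurable_coe _ fun s hs => ?_
    simp only [Measure.coe_finsetSum, Finset.sum_apply, Measure.smul_apply, smul_eq_mul]
    exact Finset.measurable_sum _ fun i _ => (S.measurable_p i).ennreal_ofReal.mul_const _

instance : IsMarkovKernel S.letterKernel where
  isProbabilityMeasure x := ⟨by
    change (∑ i, ENNReal.ofReal (S.p i x) • Measure.dirac i : Measure (Fin k)) univ = 1
    simp [← ENNReal.ofReal_sum_of_nonneg fun i _ => S.p_nonneg i x, S.sum_p x]⟩

/-- Pair a point `x` with a letter chosen at `x`. -/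
noncomputable def startKernel : Kernel X (X × Fin k) := Kernel.id ×ₖ S.letterKernel

instance : IsMarkovKernel S.startKernel := by unfold startKernel; infer_instance

lemma measurable_apply : Measurable fun z : X × Fin k => S.h z.2 z.1 :=
  measurable_from_prod_countable_left S.measurable_h

/-- From the point `y` with the letter `j`, move to `h j y` and choose the next letter there. -/
noncomputable def stepKernel : Kernel (X × Fin k) (X × Fin k) :=
  S.startKernel.comap (fun z => S.h z.2 z.1) S.measurable_apply

instance : IsMarkovKernel S.stepKernel := by unfold stepKernel; infer_instance

/-- `stepKernel` as a kernel from histories up to time `n`, through the state at time `n`. -/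
noncomputable def historyKernel (n : ℕ) :
    Kernel ((_ : Finset.Iic n) → X × Fin k) (X × Fin k) :=
  S.stepKernel.comap (fun t => t ⟨n, Finset.mem_Iic.2 le_rfl⟩) (measurable_pi_apply _)

instance (n : ℕ) : IsMarkovKernel (S.historyKernel n) := by
  unfold historyKernel; infer_instance

/-- The measures `p_x` on one-sided sequences: the law of the sequence of letters chosen by the
system started at `x`. -/
noncomputable def pathKernel : Kernel X (ℕ → Fin k) :=
  ((Kernel.traj (X := fun _ => X × Fin k) S.historyKernel 0) ∘ₖ
    (S.startKernel.map
      (MeasurableEquiv.piUnique (fun _ : Finset.Iic 0 => X × Fin k)).symm)).map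
    fun t n => (t n).2

/-- For the sequence of points and letters started at `x`: on the event that the first letters are
those of `a`, which has probability `∏ i, p (a i) (orbit a x i)`, the current point is
`orbit a x n`. -/
lemma lintegral_trajMeasure (x : X) (a : ℕ → Fin k) (n : ℕ) (f : X → ℝ≥0∞) (hf : Measurable f) :
    ∫⁻ t, {t : ℕ → X × Fin k | ∀ i ≤ n, (t i).2 = a i}.indicator (fun t => f (t n).1) t
        ∂(Kernel.trajMeasure (X := fun _ => X × Fin k) (S.startKernel x) S.historyKernel) =
      (∏ i ∈ Finset.range (n + 1), ENNReal.ofReal (S.p (a i) (S.orbit a x i))) *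
        f (S.orbit a x n) := by
  classical
  have hst : ∀ (y : X) (g : X × Fin k → ℝ≥0∞), Measurable g →
      ∫⁻ z, g z ∂(S.startKernel y) = ∑ j, ENNReal.ofReal (S.p j y) * g (y, j) := by
    intro y g hg
    rw [startKernel, Kernel.prod_apply, lintegral_prod _ hg.aemeasurable, Kernel.id_apply,
      lintegral_dirac' _ hg.lintegral_prod_right']
    change ∫⁻ j, g (y, j) ∂(∑ i, ENNReal.ofReal (S.p i y) • Measure.dirac i) = _
    simp [lintegral_finsetSum_measure, lintegral_smul_measure]
  induction n generalizing f with
  | zero =>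
    have key : (Kernel.trajMeasure (X := fun _ => X × Fin k) (S.startKernel x)
        S.historyKernel).map (fun t => t 0) = S.startKernel x := by
      have h0 : (Kernel.trajMeasure (X := fun _ => X × Fin k) (S.startKernel x)
          S.historyKernel).map (Preorder.frestrictLe 0) = (S.startKernel x).map
            (MeasurableEquiv.piUnique (fun _ : Finset.Iic 0 => X × Fin k)).symm := by
        rw [Kernel.trajMeasure, Measure.map_comp _ _ (by fun_prop), Kernel.traj_map_frestrictLe,
          Kernel.partialTraj_self, Measure.id_comp]
      have h1 := congrArg (fun m => m.map
        (MeasurableEquiv.piUnique (fun _ : Finset.Iic 0 => X × Fin k))) h0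
      simp only at h1
      rw [MeasurableEquiv.map_map_symm, Measure.map_map (by fun_prop) (by fun_prop)] at h1
      exact h1
    have e : ∀ t : ℕ → X × Fin k,
        {t : ℕ → X × Fin k | ∀ i ≤ 0, (t i).2 = a i}.indicator (fun t => f (t 0).1) t =
        (fun z : X × Fin k => if z.2 = a 0 then f z.1 else 0) (t 0) := by
      intro t
      simp [indicator_apply]
    have hg : Measurable fun z : X × Fin k => if z.2 = a 0 then f z.1 else 0 :=
      Measurable.ite (measurable_snd (measurableSet_singleton _)) (hf.comp measurable_fst)
        measurable_const
    rw [lintegral_congr e, ← lintegral_map hg (measurable_pi_apply 0), key, hst _ _ hg]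
    simp [orbit]
  | succ n ih =>
    have hg : Measurable fun z : X × Fin k => if z.2 = a (n + 1) then f z.1 else 0 :=
      Measurable.ite (measurable_snd (measurableSet_singleton _)) (hf.comp measurable_fst)
        measurable_const
    let B : Set ((_ : Finset.Iic n) → X × Fin k) := {u | ∀ i, (u i).2 = a i}
    have hB : MeasurableSet B := by
      simp only [B, ofPred_forall]
      exact MeasurableSet.iInter fun i =>
        (measurable_snd.comp (measurable_pi_apply i)) (measurableSet_singleton (a i))
    let G : ((_ : Finset.Iic n) → X × Fin k) × (X × Fin k) → ℝ≥0∞ := fun q =>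
      B.indicator 1 q.1 * (fun z : X × Fin k => if z.2 = a (n + 1) then f z.1 else 0) q.2
    have hG : Measurable G :=
      ((measurable_one.indicator hB).comp measurable_fst).mul (hg.comp measurable_snd)
    have e : ∀ t : ℕ → X × Fin k,
        {t : ℕ → X × Fin k | ∀ i ≤ n + 1, (t i).2 = a i}.indicator
          (fun t => f (t (n + 1)).1) t = G (Preorder.frestrictLe n t, t (n + 1)) := by
      intro t
      have h1 : (∀ i ≤ n + 1, (t i).2 = a i) ↔
          (Preorder.frestrictLe n t ∈ B ∧ (t (n + 1)).2 = a (n + 1)) := by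
        constructor
        · intro h
          exact ⟨fun i => h i ((Finset.mem_Iic.1 i.2).trans n.le_succ), h _ le_rfl⟩
        · rintro ⟨h, h'⟩ i hi
          rcases Nat.le_succ_iff.1 hi with hi | rfl
          · exact h ⟨i, Finset.mem_Iic.2 hi⟩
          · exact h'
      by_cases hb : Preorder.frestrictLe n t ∈ B <;>
        by_cases hc : (t (n + 1)).2 = a (n + 1) <;>
        simp [G, indicator_apply, h1, hb, hc]
    have hmeas : Measurable fun t : ℕ → X × Fin k =>
        ((Preorder.frestrictLe n t : (_ : Finset.Iic n) → X × Fin k), t (n + 1)) := by fun_prop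
    have hfr : Measurable fun t : ℕ → X × Fin k =>
        (Preorder.frestrictLe n t : (_ : Finset.Iic n) → X × Fin k) := by fun_prop
    rw [lintegral_congr e, ← lintegral_map hG hmeas,
      ← Kernel.map_frestrictLe_trajMeasure_compProd_eq_map_trajMeasure,
      Measure.lintegral_compProd hG, lintegral_map hG.lintegral_kernel_prod_right' hfr]
    have hf' : Measurable fun y => ENNReal.ofReal (S.p (a (n + 1)) (S.h (a n) y)) *
        f (S.h (a n) y) :=
      (((S.measurable_p _).comp (S.measurable_h _)).ennreal_ofReal).mul
        (hf.comp (S.measurable_h _))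
    have e2 : ∀ t : ℕ → X × Fin k,
        ∫⁻ z, G (Preorder.frestrictLe n t, z) ∂(S.historyKernel n (Preorder.frestrictLe n t)) =
        {t : ℕ → X × Fin k | ∀ i ≤ n, (t i).2 = a i}.indicator
          (fun t => ENNReal.ofReal (S.p (a (n + 1)) (S.h (a n) (t n).1)) *
            f (S.h (a n) (t n).1)) t := by
      intro t
      have h2 : Preorder.frestrictLe n t ∈ B ↔ ∀ i ≤ n, (t i).2 = a i :=
        ⟨fun h i hi => h ⟨i, Finset.mem_Iic.2 hi⟩, fun h i => h i (Finset.mem_Iic.1 i.2)⟩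
      have h3 : S.historyKernel n (Preorder.frestrictLe n t) =
          S.startKernel (S.h (t n).2 (t n).1) := rfl
      rw [h3]
      simp only [G]
      rw [lintegral_const_mul _ hg, hst _ _ hg]
      by_cases hb : ∀ i ≤ n, (t i).2 = a i
      · simp [indicator_apply, h2, hb]
      · simp [h2, hb]
    rw [lintegral_congr e2, ih _ hf', Finset.prod_range_succ _ (n + 1), mul_assoc]
    rfl

/-- The characterization of `p_x`: the cylinder of all sequences that begin with the letters
`a_1, …, a_n` has measure `p_{a_1}(x) p_{a_2}(h_{a_1} x) ⋯ p_{a_n}(h_{a_{n-1}} ⋯ h_{a_1} x)`. -/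
theorem pathKernel_cylinder (x : X) (a : ℕ → Fin k) (n : ℕ) :
    S.pathKernel x {ω | ∀ i < n, ω i = a i} =
      ENNReal.ofReal (∏ i ∈ Finset.range n, S.p (a i) (S.orbit a x i)) := by
  rw [pathKernel, Kernel.map_apply _ (by fun_prop), Kernel.comp_apply,
    Kernel.map_apply _ (by fun_prop)]
  change ((Kernel.trajMeasure (X := fun _ => X × Fin k) (S.startKernel x) S.historyKernel).map
    fun t n => (t n).2) _ = _
  have hm : MeasurableSet {ω : ℕ → Fin k | ∀ i < n, ω i = a i} := by
    simp only [ofPred_forall]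
    exact MeasurableSet.iInter fun i => MeasurableSet.iInter fun _ =>
      measurableSet_eq_fun (measurable_pi_apply i) measurable_const
  rw [Measure.map_apply (by fun_prop) hm]
  cases n with
  | zero => simp
  | succ n =>
    have h := S.lintegral_trajMeasure x a n 1 measurable_one
    have hs : (fun (t : ℕ → X × Fin k) n => (t n).2) ⁻¹' {ω | ∀ i < n + 1, ω i = a i} =
        {t : ℕ → X × Fin k | ∀ i ≤ n, (t i).2 = a i} := by
      ext t
      simp
    rw [ENNReal.ofReal_prod_of_nonneg fun i _ => S.p_nonneg _ _, hs]
    have hp := hm.preimage (f := fun (t : ℕ → X × Fin k) n => (t n).2) (by fun_prop)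
    rw [hs] at hp
    rw [← lintegral_indicator_one hp]
    simp only [Pi.one_apply, mul_one] at h
    exact h

instance : IsMarkovKernel S.pathKernel := by
  unfold pathKernel
  have := Kernel.IsMarkovKernel.map S.startKernel
    (MeasurableEquiv.piUnique (fun _ : Finset.Iic 0 => X × Fin k)).symm.measurable
  exact Kernel.IsMarkovKernel.map _ (by fun_prop)

/-- The measure `μ₊(dω) = ∫ p_x(dω) dν(x)` on one-sided sequences. -/
noncomputable def forwardMeasure (ν : Measure X) : Measure (ℕ → Fin k) :=
  ν.bind S.pathKernel

end

end IFS

/-- The left shift on two-sided sequences. -/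
def twoSidedShift {A : Type*} (ω : ℤ → A) : ℤ → A := fun i => ω (i + 1)

/-- The positive coordinates `(ω_1, ω_2, …)` of a two-sided sequence. -/
def positiveCoordinates {A : Type*} (ω : ℤ → A) : ℕ → A := fun n => ω (n + 1)

/-- `μ` is a natural extension of the measure `m` on one-sided sequences: it is invariant under the
two-sided shift, and `m` is its marginal on the positive coordinates. -/
structure IsNaturalExtension {A : Type*} [MeasurableSpace A] (m : Measure (ℕ → A))
    (μ : Measure (ℤ → A)) : Prop where
  invariant : MeasurePreserving twoSidedShift μ μ
  marginal : μ.map positiveCoordinates = m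

open Filter Topology symmDiff

/-! Invariance of `ν` makes `μ₊` shift-invariant, so a two-sided extension exists by compactness and
is unique because shifting a cylinder far enough leaves only positive coordinates. Those coordinates
also determine invariant events up to null sets, so ergodicity passes from `μ₊` to the extension
(`IsNaturalExtension.ergodic`).

Ergodicity of `μ₊` combines two facts about a shift-invariant event `B`. By stationarity and the
Markov property, `p_x(B)` is `0` or `1` for `ν`-almost every `x` (`ae_pathKernel_eq_zero_or`). And
no two measures `p_x`, `p_y` are mutually singular (`pathKernel_ne_zero_or`), so the values `0` and
`1` cannot both occur.

For the second fact, contraction on average makes `d^q` contract in mean for some small `q > 0`. Two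
orbits driven by the same letters thus approach geometrically in mean, and the Dini condition bounds
the expected total variation of the probabilities along them. Since the `p_i` are at least `ε`, the
likelihood ratio of `p_y` to `p_x` on the first `n` letters is bounded below, uniformly in `n`, on
an event of `p_x`-probability at least `1/2`. -/

/-! ### One-sided and two-sided shifts -/

/-- The left shift on one-sided sequences. -/
def oneSidedShift {A : Type*} (ω : ℕ → A) : ℕ → A := fun n => ω (n + 1)

/-- The two-sided sequence whose coordinates from `1 - n` on are those of `ω`, padded on the left
by the first letter of `ω`. -/
def extendLeft {A : Type*} (n : ℕ) (ω : ℕ → A) : ℤ → A := fun i => ω (i + n - 1).toNat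

section Shift

variable {A : Type*}

lemma positiveCoordinates_twoSidedShift (ω : ℤ → A) :
    positiveCoordinates (twoSidedShift ω) = oneSidedShift (positiveCoordinates ω) := by
  funext n
  simp [positiveCoordinates, twoSidedShift, oneSidedShift]

lemma twoSidedShift_extendLeft (n : ℕ) (ω : ℕ → A) :
    twoSidedShift (extendLeft n ω) = extendLeft (n + 1) ω := by
  funext i
  simp only [twoSidedShift, extendLeft]
  congr 2
  push_cast
  ring

lemma positiveCoordinates_extendLeft (n : ℕ) (ω : ℕ → A) :
    positiveCoordinates (extendLeft n ω) = oneSidedShift^[n] ω := by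
  induction n with
  | zero => funext j; simp [positiveCoordinates, extendLeft]
  | succ n ih =>
    rw [← twoSidedShift_extendLeft, positiveCoordinates_twoSidedShift, ih,
      Function.iterate_succ_apply']

lemma twoSidedShift_iterate_apply (n : ℕ) (ω : ℤ → A) (i : ℤ) :
    (twoSidedShift^[n] ω) i = ω (i + n) := by
  induction n generalizing ω with
  | zero => simp
  | succ n ih =>
    rw [Function.iterate_succ_apply, ih]
    simp only [twoSidedShift]
    congr 1
    push_cast
    ring

lemma extendLeft_oneSidedShift_apply {n : ℕ} {i : ℤ} (h : 1 ≤ i + n) (ω : ℕ → A) :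
    extendLeft n (oneSidedShift ω) i = extendLeft (n + 1) ω i := by
  simp only [extendLeft, oneSidedShift]
  congr 1
  omega

lemma extendLeft_positiveCoordinates_apply {n : ℕ} {i : ℤ} (h : 1 ≤ i + n) (ω : ℤ → A) :
    extendLeft n (positiveCoordinates ω) i = (twoSidedShift^[n] ω) i := by
  rw [twoSidedShift_iterate_apply]
  simp only [extendLeft, positiveCoordinates]
  congr 1
  omega

lemma exists_forall_one_le_add (s : Finset ℤ) : ∃ N : ℕ, ∀ n ≥ N, ∀ i ∈ s, 1 ≤ i + (n : ℤ) := by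
  refine ⟨∑ i ∈ s, (1 - i).toNat, fun n hn i hi => ?_⟩
  have := Finset.single_le_sum (f := fun i : ℤ => (1 - i).toNat) (fun _ _ => Nat.zero_le _) hi
  omega

variable [MeasurableSpace A]

lemma measurable_oneSidedShift : Measurable (oneSidedShift : (ℕ → A) → ℕ → A) :=
  measurable_pi_lambda _ fun _ => measurable_pi_apply _

lemma measurable_twoSidedShift : Measurable (twoSidedShift : (ℤ → A) → ℤ → A) :=
  measurable_pi_lambda _ fun _ => measurable_pi_apply _

lemma measurable_positiveCoordinates : Measurable (positiveCoordinates : (ℤ → A) → ℕ → A) :=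
  measurable_pi_lambda _ fun _ => measurable_pi_apply _

lemma measurable_extendLeft (n : ℕ) : Measurable (extendLeft n : (ℕ → A) → ℤ → A) :=
  measurable_pi_lambda _ fun _ => measurable_pi_apply _

/-- A cylinder reads finitely many coordinates; for large `n` all of them are at least `1 - n`, so
the padding in `extendLeft n` is not seen. -/
lemma eventually_preimage_extendLeft {C : Set (ℤ → A)}
    (hC : C ∈ measurableCylinders fun _ : ℤ => A) :
    ∀ᶠ n in atTop, (positiveCoordinates ⁻¹' (extendLeft n ⁻¹' C) = twoSidedShift^[n] ⁻¹' C ∧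
      extendLeft (n + 1) ⁻¹' C = oneSidedShift ⁻¹' (extendLeft n ⁻¹' C)) := by
  obtain ⟨s, S, -, rfl⟩ := (mem_measurableCylinders C).1 hC
  obtain ⟨N, hN⟩ := exists_forall_one_le_add s
  filter_upwards [eventually_ge_atTop N] with n hn
  constructor
  · ext ω
    simp only [mem_preimage, mem_cylinder]
    rw [show s.restrict (extendLeft n (positiveCoordinates ω)) =
      s.restrict (twoSidedShift^[n] ω) from
        funext fun i => extendLeft_positiveCoordinates_apply (hN n hn i i.2) ω]
  · ext ω
    simp only [mem_preimage, mem_cylinder]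
    rw [show s.restrict (extendLeft n (oneSidedShift ω)) = s.restrict (extendLeft (n + 1) ω) from
        funext fun i => extendLeft_oneSidedShift_apply (hN n hn i i.2) ω]

lemma ext_of_measurableCylinders {ι : Type*} {μ μ' : Measure (ι → A)} [IsFiniteMeasure μ]
    (huniv : μ univ = μ' univ)
    (h : ∀ C ∈ measurableCylinders fun _ : ι => A, μ C = μ' C) : μ = μ' :=
  ext_of_generate_finite _ generateFrom_measurableCylinders.symm isPiSystem_measurableCylinders
    h huniv

lemma exists_measurableCylinders_symmDiff_lt {ι : Type*} (μ : Measure (ι → A))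
    [IsFiniteMeasure μ] {s : Set (ι → A)} (hs : MeasurableSet s) {δ : ℝ} (hδ : 0 < δ) :
    ∃ C ∈ measurableCylinders fun _ : ι => A, μ (s ∆ C) < ENNReal.ofReal δ :=
  (Measure.MeasureDense.of_generateFrom_isSetAlgebra_finite μ isSetAlgebra_measurableCylinders
    generateFrom_measurableCylinders.symm).approx s hs (measure_ne_top _ _) δ hδ

end Shift

/-! ### The natural extension -/

namespace IsNaturalExtension

variable {A : Type*} [MeasurableSpace A] {m : Measure (ℕ → A)} {μ μ' : Measure (ℤ → A)}

lemma measure_univ_eq (h : IsNaturalExtension m μ) : μ univ = m univ := by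
  rw [← h.marginal, Measure.map_apply measurable_positiveCoordinates .univ, preimage_univ]

/-- Invariance moves the cylinder into the positive coordinates, where `μ` is `m`. Uniqueness
follows, since the right-hand side does not mention `μ`. -/
lemma eventually_measure_eq (h : IsNaturalExtension m μ) {C : Set (ℤ → A)}
    (hC : C ∈ measurableCylinders fun _ : ℤ => A) :
    ∀ᶠ n in atTop, μ C = m (extendLeft n ⁻¹' C) := by
  have hCm := MeasurableSet.of_mem_measurableCylinders hC
  filter_upwards [eventually_preimage_extendLeft hC] with n hn
  rw [← h.marginal, Measure.map_apply measurable_positiveCoordinates (measurable_extendLeft n hCm),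
    hn.1, (h.invariant.iterate n).measure_preimage hCm.nullMeasurableSet]

lemma eq [IsFiniteMeasure m] (h : IsNaturalExtension m μ) (h' : IsNaturalExtension m μ') :
    μ = μ' := by
  have : IsFiniteMeasure μ := ⟨by rw [h.measure_univ_eq]; exact measure_lt_top _ _⟩
  refine ext_of_measurableCylinders (h.measure_univ_eq.trans h'.measure_univ_eq.symm)
    fun C hC => ?_
  obtain ⟨n, h1, h2⟩ := ((h.eventually_measure_eq hC).and (h'.eventually_measure_eq hC)).exists
  rw [h1, h2]

/-- A strictly invariant set of the two-sided shift is, up to null sets, determined by the positive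
coordinates. -/
lemma exists_preimage_positiveCoordinates_ae_eq [IsFiniteMeasure m] (h : IsNaturalExtension m μ)
    {s : Set (ℤ → A)} (hs : MeasurableSet s) (hinv : twoSidedShift ⁻¹' s = s) :
    ∃ B : Set (ℕ → A), MeasurableSet B ∧ positiveCoordinates ⁻¹' B =ᵐ[μ] s := by
  have : IsFiniteMeasure μ := ⟨by rw [h.measure_univ_eq]; exact measure_lt_top _ _⟩
  have hit : ∀ n, twoSidedShift^[n] ⁻¹' s = s := by
    intro n
    induction n with
    | zero => rfl
    | succ n ih => rw [Function.iterate_succ, preimage_comp, ih, hinv]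
  have key : ∀ j : ℕ, ∃ B : Set (ℕ → A), MeasurableSet B ∧
      μ (s ∆ (positiveCoordinates ⁻¹' B)) ≤ ENNReal.ofReal ((1 / 2 : ℝ) ^ j) := by
    intro j
    obtain ⟨C, hC, hlt⟩ := exists_measurableCylinders_symmDiff_lt μ hs
      (show (0 : ℝ) < (1 / 2) ^ j by positivity)
    obtain ⟨n, hn, -⟩ := (eventually_preimage_extendLeft hC).exists
    have hCm := MeasurableSet.of_mem_measurableCylinders hC
    refine ⟨extendLeft n ⁻¹' C, measurable_extendLeft n hCm, ?_⟩
    rw [hn]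
    -- As `s` equals its own `n`-th preimage, shifting the approximating cylinder into the positive
    -- coordinates leaves the error unchanged.
    nth_rewrite 1 [← hit n]
    rw [← preimage_symmDiff,
      (h.invariant.iterate n).measure_preimage (hs.symmDiff hCm).nullMeasurableSet]
    exact hlt.le
  choose B hB hlt using key
  -- Borel–Cantelli: the errors are summable, so almost every `ω` lies in only finitely many of the
  -- symmetric differences.
  refine ⟨limsup B atTop, .measurableSet_limsup hB, ?_⟩
  have hsum : ∑' j, μ (s ∆ (positiveCoordinates ⁻¹' B j)) ≠ ∞ := by
    refine ne_top_of_le_ne_top ?_ (ENNReal.tsum_le_tsum hlt)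
    rw [← ENNReal.ofReal_tsum_of_nonneg (fun _ => by positivity) summable_geometric_two]
    exact ENNReal.ofReal_ne_top
  have hae := ae_eventually_notMem hsum
  filter_upwards [hae] with ω hω
  apply propext
  change positiveCoordinates ω ∈ limsup B atTop ↔ ω ∈ s
  rw [mem_limsup_iff_frequently_mem]
  have h3 : ∀ᶠ j in atTop, (positiveCoordinates ω ∈ B j ↔ ω ∈ s) := by
    filter_upwards [hω] with j hj
    simp only [mem_symmDiff, mem_preimage] at hj
    tauto
  constructor
  · intro hf
    obtain ⟨j, h1, h2⟩ := (hf.and_eventually h3).exists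
    exact h2.1 h1
  · intro hω
    exact (h3.mono fun j hj => hj.2 hω).frequently

/-- A natural extension of an ergodic measure is ergodic. -/
theorem ergodic [IsFiniteMeasure m] (h : IsNaturalExtension m μ) (hm : Ergodic oneSidedShift m) :
    Ergodic twoSidedShift μ := by
  refine { h.invariant with aeconst_set := fun s hs hinv => ?_ }
  obtain ⟨B, hB, hBs⟩ := h.exists_preimage_positiveCoordinates_ae_eq hs hinv
  have hpos : MeasurePreserving positiveCoordinates μ m :=
    ⟨measurable_positiveCoordinates, h.marginal⟩
  have hB' : oneSidedShift ⁻¹' B =ᵐ[m] B := by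
    have h1 : positiveCoordinates ⁻¹' (oneSidedShift ⁻¹' B) =ᵐ[μ] positiveCoordinates ⁻¹' B := by
      have h2 : positiveCoordinates ⁻¹' (oneSidedShift ⁻¹' B) =
          twoSidedShift ⁻¹' (positiveCoordinates ⁻¹' B) := by
        ext ω
        simp only [mem_preimage, positiveCoordinates_twoSidedShift]
      rw [h2]
      refine (h.invariant.quasiMeasurePreserving.preimage_ae_eq hBs).trans ?_
      rw [hinv]
      exact hBs.symm
    rw [← measure_symmDiff_eq_zero_iff, ← preimage_symmDiff,
      hpos.measure_preimage ((measurable_oneSidedShift hB).symmDiff hB).nullMeasurableSet] at h1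
    exact measure_symmDiff_eq_zero_iff.1 h1
  have h4 := hm.quasiErgodic.ae_empty_or_univ₀ hB.nullMeasurableSet hB'
  rw [eventuallyConst_set']
  rcases h4 with h4 | h4
  · exact .inl (hBs.symm.trans (hpos.quasiMeasurePreserving.preimage_ae_eq h4))
  · exact .inr (hBs.symm.trans (hpos.quasiMeasurePreserving.preimage_ae_eq h4))

end IsNaturalExtension

lemma isClopen_of_mem_measurableCylinders {ι A : Type*} [TopologicalSpace A] [DiscreteTopology A]
    [MeasurableSpace A] {C : Set (ι → A)} (hC : C ∈ measurableCylinders fun _ : ι => A) :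
    IsClopen C := by
  obtain ⟨s, S, -, rfl⟩ := (mem_measurableCylinders C).1 hC
  exact (isClopen_discrete S).preimage (by fun_prop)

/-- A shift-invariant probability measure on one-sided sequences over a finite alphabet has a
natural extension. -/
theorem exists_isNaturalExtension {A : Type*} [Finite A] [TopologicalSpace A] [DiscreteTopology A]
    [MeasurableSpace A] [BorelSpace A] {m : Measure (ℕ → A)} [IsProbabilityMeasure m]
    (hm : MeasurePreserving oneSidedShift m m) : ∃ μ, IsNaturalExtension m μ := by
  let P : ℕ → ProbabilityMeasure (ℤ → A) := fun n =>
    ⟨m.map (extendLeft n), Measure.isProbabilityMeasure_map (measurable_extendLeft n).aemeasurable⟩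
  -- The alphabet is finite, so the probability measures on two-sided sequences form a compact space
  -- and `P` converges along an ultrafilter.
  let U : Ultrafilter (ProbabilityMeasure (ℤ → A)) := (hyperfilter ℕ).map P
  obtain ⟨μ, -, hμ⟩ := isCompact_univ.ultrafilter_le_nhds U (by simp)
  have hlim : Tendsto P (hyperfilter ℕ) (𝓝 μ) := hμ
  -- Clopen sets have empty frontier, so weak convergence gives convergence of their measures.
  have key : ∀ {C : Set (ℤ → A)} {c : ℝ≥0∞}, IsClopen C →
      (∀ᶠ n in atTop, m (extendLeft n ⁻¹' C) = c) → (μ : Measure (ℤ → A)) C = c := by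
    intro C c hC hc
    have h1 := ProbabilityMeasure.tendsto_measure_of_null_frontier_of_tendsto' hlim (E := C)
      (by rw [hC.frontier_eq, measure_empty])
    have h2 : ∀ᶠ n in (hyperfilter ℕ : Filter ℕ), (P n : Measure (ℤ → A)) C = c := by
      have h3 : (hyperfilter ℕ : Filter ℕ) ≤ atTop := by
        rw [← Nat.cofinite_eq_atTop]
        exact hyperfilter_le_cofinite
      filter_upwards [h3 hc] with n hn
      rw [← hn]
      exact Measure.map_apply (measurable_extendLeft n) hC.isOpen.measurableSet
    exact tendsto_nhds_unique h1 (tendsto_const_nhds.congr' (h2.mono fun _ h => h.symm))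
  have hshift : Continuous (twoSidedShift : (ℤ → A) → ℤ → A) :=
    continuous_pi fun _ => continuous_apply _
  have hpos : Continuous (positiveCoordinates : (ℤ → A) → ℕ → A) :=
    continuous_pi fun _ => continuous_apply _
  refine ⟨μ, ⟨measurable_twoSidedShift, ?_⟩, ?_⟩
  · have := Measure.isProbabilityMeasure_map (μ := (μ : Measure (ℤ → A)))
      measurable_twoSidedShift.aemeasurable
    refine ext_of_measurableCylinders (by simp) fun C hC => ?_
    have hcl := isClopen_of_mem_measurableCylinders hC
    rw [Measure.map_apply measurable_twoSidedShift hcl.isOpen.measurableSet]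
    obtain ⟨N, hN⟩ := eventually_atTop.1 (eventually_preimage_extendLeft hC)
    have hconst : ∀ n ≥ N, m (extendLeft n ⁻¹' C) = m (extendLeft N ⁻¹' C) := by
      intro n hn
      induction n, hn using Nat.le_induction with
      | base => rfl
      | succ n hn ih =>
        rw [(hN n hn).2, hm.measure_preimage
          (measurable_extendLeft n hcl.isOpen.measurableSet).nullMeasurableSet, ih]
    rw [key hcl (eventually_atTop.2 ⟨N, hconst⟩)]
    refine key (hcl.preimage hshift) (eventually_atTop.2 ⟨N, fun n hn => ?_⟩)
    rw [← preimage_comp, show twoSidedShift ∘ extendLeft n = extendLeft (A := A) (n + 1) from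
      funext (twoSidedShift_extendLeft n)]
    exact hconst _ (by omega)
  · have := Measure.isProbabilityMeasure_map (μ := (μ : Measure (ℤ → A)))
      measurable_positiveCoordinates.aemeasurable
    refine ext_of_measurableCylinders (by simp) fun D hD => ?_
    have hcl := isClopen_of_mem_measurableCylinders hD
    rw [Measure.map_apply measurable_positiveCoordinates hcl.isOpen.measurableSet]
    refine key (hcl.preimage hpos) (.of_forall fun n => ?_)
    rw [← preimage_comp, show positiveCoordinates ∘ extendLeft n =
      (oneSidedShift^[n] : (ℕ → A) → ℕ → A)
      from funext (positiveCoordinates_extendLeft n)]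
    exact (hm.iterate n).measure_preimage hcl.isOpen.measurableSet.nullMeasurableSet

/-! ### The Markov property of the path measures -/

/-- The sequence that begins with the letter `i` and continues with `ω`. -/
def prependLetter {A : Type*} (i : A) (ω : ℕ → A) : ℕ → A
  | 0 => i
  | n + 1 => ω n

lemma measurable_prependLetter {A : Type*} [MeasurableSpace A] (i : A) :
    Measurable (prependLetter i) := by
  refine measurable_pi_lambda _ fun n => ?_
  cases n with
  | zero => exact measurable_const
  | succ n => exact measurable_pi_apply n

lemma measurableSet_cylinder {A : Type*} [Countable A] [MeasurableSpace A]
    [MeasurableSingletonClass A] (a : ℕ → A) (n : ℕ) :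
    MeasurableSet {ω : ℕ → A | ∀ i < n, ω i = a i} := by
  simp only [ofPred_forall]
  exact MeasurableSet.iInter fun i => MeasurableSet.iInter fun _ =>
    measurableSet_eq_fun (measurable_pi_apply i) measurable_const

/-- Finite measures on sequences that agree on the cylinders of initial words are equal. -/
lemma ext_of_cylinder {A : Type*} [Countable A] [MeasurableSpace A]
    [MeasurableSingletonClass A] {μ μ' : Measure (ℕ → A)} [IsFiniteMeasure μ]
    (huniv : μ univ = μ' univ)
    (h : ∀ (a : ℕ → A) (n : ℕ), μ {ω | ∀ i < n, ω i = a i} = μ' {ω | ∀ i < n, ω i = a i}) :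
    μ = μ' := by
  classical
  refine ext_of_generate_finite
    {s | ∃ (a : ℕ → A) (n : ℕ), s = {ω : ℕ → A | ∀ i < n, ω i = a i}} ?_ ?_ ?_ huniv
  · apply le_antisymm
    · refine iSup_le fun j => ?_
      rw [← measurable_iff_comap_le]
      refine @measurable_to_countable' A (ℕ → A) _ _ (_) _ fun b => ?_
      -- A condition on letter `j` is a countable union over the words of length `j + 1` ending in
      -- `b`.
      have : (fun ω : ℕ → A => ω j) ⁻¹' {b} = ⋃ w : {w : Fin (j + 1) → A // w (Fin.last j) = b},
          {ω : ℕ → A | ∀ i < j + 1, ω i = (fun i => if hi : i < j + 1 then w.1 ⟨i, hi⟩ else b) i}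
          := by
        ext ω
        simp only [mem_preimage, mem_singleton_iff, mem_iUnion]
        constructor
        · intro hω
          exact ⟨⟨fun i => ω i, hω⟩, fun i hi => by simp [hi]⟩
        · rintro ⟨w, hw⟩
          have := hw j (Nat.lt_succ_self j)
          simp only [Nat.lt_succ_self, dite_true] at this
          rw [this]
          exact w.2
      rw [this]
      exact MeasurableSet.iUnion fun w => MeasurableSpace.measurableSet_generateFrom ⟨_, _, rfl⟩
    · refine MeasurableSpace.generateFrom_le ?_
      rintro s ⟨a, n, rfl⟩
      exact measurableSet_cylinder a n
  · rintro s ⟨a, n, rfl⟩ t ⟨a', n', rfl⟩ ⟨ω, h1, h2⟩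
    refine ⟨ω, max n n', ?_⟩
    ext ω'
    constructor
    · rintro ⟨h3, h4⟩ i hi
      rcases lt_max_iff.1 hi with hi | hi
      · rw [h3 i hi, h1 i hi]
      · rw [h4 i hi, h2 i hi]
    · intro h3
      exact ⟨fun i hi => (h3 i (hi.trans_le (le_max_left _ _))).trans (h1 i hi),
        fun i hi => (h3 i (hi.trans_le (le_max_right _ _))).trans (h2 i hi)⟩
  · rintro s ⟨a, n, rfl⟩
    exact h a n

namespace IFS

variable {X : Type*} [MeasurableSpace X] {k : ℕ} (S : IFS X k)

lemma orbit_prependLetter (i : Fin k) (ω : ℕ → Fin k) (x : X) (n : ℕ) :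
    S.orbit (prependLetter i ω) x (n + 1) = S.orbit ω (S.h i x) n := by
  induction n with
  | zero => rfl
  | succ n ih => rw [orbit, ih]; rfl

lemma measurable_orbit (n : ℕ) :
    Measurable fun z : X × (ℕ → Fin k) => S.orbit z.2 z.1 n := by
  induction n with
  | zero => exact measurable_fst
  | succ n ih =>
    exact S.measurable_apply.comp (ih.prodMk ((measurable_pi_apply n).comp measurable_snd))

lemma measurable_orbit_right (x : X) (n : ℕ) :
    Measurable fun ω : ℕ → Fin k => S.orbit ω x n :=
  (S.measurable_orbit n).comp measurable_prodMk_left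

lemma sum_ofReal_p (x : X) : ∑ i, ENNReal.ofReal (S.p i x) = 1 := by
  rw [← ENNReal.ofReal_sum_of_nonneg fun i _ => S.p_nonneg i x, S.sum_p x, ENNReal.ofReal_one]

/-- First-step decomposition: on a cylinder only the summand of its first letter survives, and the
product formula factors. It drives the later inductions on the number of letters. -/
lemma pathKernel_eq_sum (x : X) :
    S.pathKernel x = ∑ i, ENNReal.ofReal (S.p i x) •
      (S.pathKernel (S.h i x)).map (prependLetter i) := by
  have huniv : S.pathKernel x univ = (∑ i, ENNReal.ofReal (S.p i x) •
      (S.pathKernel (S.h i x)).map (prependLetter i)) univ := by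
    simp only [measure_univ, Measure.coe_finsetSum, Finset.sum_apply, Measure.smul_apply,
      smul_eq_mul, Measure.map_apply (measurable_prependLetter _) MeasurableSet.univ,
      preimage_univ, mul_one]
    exact (S.sum_ofReal_p x).symm
  refine ext_of_cylinder huniv fun a n => ?_
  cases n with
  | zero => simpa using huniv
  | succ n =>
    simp only [Measure.coe_finsetSum, Finset.sum_apply, Measure.smul_apply, smul_eq_mul,
      Measure.map_apply (measurable_prependLetter _) (measurableSet_cylinder a (n + 1))]
    rw [Finset.sum_eq_single (a 0)]
    · have : prependLetter (a 0) ⁻¹' {ω | ∀ i < n + 1, ω i = a i} =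
          {ω | ∀ i < n, ω i = a (i + 1)} := by
        ext ω
        constructor
        · exact fun h i hi => h (i + 1) (by omega)
        · rintro h (_ | i) hi
          · rfl
          · exact h i (by omega)
      rw [this, S.pathKernel_cylinder x a (n + 1),
        S.pathKernel_cylinder (S.h (a 0) x) (fun i => a (i + 1)) n,
        ← ENNReal.ofReal_mul (S.p_nonneg _ _), Finset.prod_range_succ', mul_comm]
      congr 2
      refine Finset.prod_congr rfl fun i _ => ?_
      rw [← orbit_prependLetter]
      congr 2
      funext j
      cases j <;> rfl
    · intro i _ hi
      have : prependLetter i ⁻¹' {ω | ∀ i < n + 1, ω i = a i} = ∅ := by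
        ext ω
        simp only [mem_preimage, mem_ofPred_eq, mem_empty_iff_false, iff_false]
        exact fun h => hi (h 0 (by omega))
      rw [this, measure_empty, mul_zero]
    · simp

lemma lintegral_pathKernel (x : X) {f : (ℕ → Fin k) → ℝ≥0∞} (hf : Measurable f) :
    ∫⁻ ω, f ω ∂(S.pathKernel x) =
      ∑ i, ENNReal.ofReal (S.p i x) * ∫⁻ ω, f (prependLetter i ω) ∂(S.pathKernel (S.h i x)) := by
  conv_lhs => rw [pathKernel_eq_sum]
  simp [lintegral_finsetSum_measure, lintegral_smul_measure,
    lintegral_map hf (measurable_prependLetter _)]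

lemma dependsOn_prependLetter {β : Type*} {f : (ℕ → Fin k) → β} {n : ℕ}
    (hf : DependsOn f (Iio (n + 1))) (i : Fin k) :
    DependsOn (fun ω => f (prependLetter i ω)) (Iio n) := by
  intro ω ω' h
  refine hf fun j hj => ?_
  cases j with
  | zero => rfl
  | succ j => exact h j (by simpa using hj)

/-- The Markov property: given the first `n` letters, the law of the remaining ones is the path
measure of the current point. -/
lemma lintegral_mul_shift {n : ℕ} {f g : (ℕ → Fin k) → ℝ≥0∞} (hf : Measurable f)
    (hg : Measurable g) (hfn : DependsOn f (Iio n)) (x : X) :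
    ∫⁻ ω, f ω * g (oneSidedShift^[n] ω) ∂(S.pathKernel x) =
      ∫⁻ ω, f ω * ∫⁻ ω', g ω' ∂(S.pathKernel (S.orbit ω x n)) ∂(S.pathKernel x) := by
  have hG : Measurable fun y => ∫⁻ ω', g ω' ∂(S.pathKernel y) := hg.lintegral_kernel
  have hsh : ∀ n, Measurable (oneSidedShift^[n] : (ℕ → Fin k) → ℕ → Fin k) :=
    fun n => measurable_oneSidedShift.iterate n
  -- Splitting off the first letter `i` replaces `x` by `S.h i x` and `f` by a function of one
  -- letter fewer.
  induction n generalizing f x with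
  | zero =>
    obtain hk | hk := isEmpty_or_nonempty (ℕ → Fin k)
    · have := (S.pathKernel x).eq_zero_of_isEmpty
      simp [this]
    · obtain ⟨ω₀⟩ := hk
      have hc : ∀ ω, f ω = f ω₀ := fun ω => hfn fun i hi => absurd hi (by simp)
      simp only [hc, Function.iterate_zero, id_eq, orbit]
      rw [lintegral_const_mul _ hg, lintegral_const, measure_univ, mul_one]
  | succ n ih =>
    rw [S.lintegral_pathKernel x (f := fun ω => f ω * g (oneSidedShift^[n + 1] ω))
        (hf.mul (hg.comp (hsh _))),
      S.lintegral_pathKernel x (f := fun ω => f ω * ∫⁻ ω', g ω' ∂(S.pathKernel (S.orbit ω x (n + 1))))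
        (hf.mul (hG.comp (S.measurable_orbit_right x _)))]
    refine Finset.sum_congr rfl fun i _ => ?_
    congr 1
    simp only [orbit_prependLetter]
    exact ih (hf.comp (measurable_prependLetter i)) (dependsOn_prependLetter hfn i) (S.h i x)

variable {S} {ν : Measure X}

/-- The dual form of `S.transfer ν = ν`, through which the fixed-point equation is used. -/
lemma IsInvariantMeasure.lintegral_sum (hν : S.IsInvariantMeasure ν) {g : X → ℝ≥0∞}
    (hg : Measurable g) :
    ∫⁻ x, ∑ i, ENNReal.ofReal (S.p i x) * g (S.h i x) ∂ν = ∫⁻ x, g x ∂ν := by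
  conv_rhs => rw [← hν.transfer_eq, transfer, lintegral_finsetSum_measure]
  rw [lintegral_finsetSum (f := fun i x => ENNReal.ofReal (S.p i x) * g (S.h i x)) _ fun i _ =>
    (S.measurable_p i).ennreal_ofReal.mul (hg.comp (S.measurable_h i))]
  refine Finset.sum_congr rfl fun i _ => ?_
  rw [lintegral_map hg (S.measurable_h i)]
  exact (lintegral_withDensity_eq_lintegral_mul _
    (S.measurable_p i).ennreal_ofReal (hg.comp (S.measurable_h i))).symm

/-- Stationarity: started from `ν`, the point at time `n` again has law `ν`. -/
lemma IsInvariantMeasure.lintegral_orbit (hν : S.IsInvariantMeasure ν) {g : X → ℝ≥0∞}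
    (hg : Measurable g) (n : ℕ) :
    ∫⁻ x, ∫⁻ ω, g (S.orbit ω x n) ∂(S.pathKernel x) ∂ν = ∫⁻ x, g x ∂ν := by
  induction n with
  | zero => simp [orbit]
  | succ n ih =>
    have hG : Measurable fun x => ∫⁻ ω, g (S.orbit ω x n) ∂(S.pathKernel x) :=
      (hg.comp (S.measurable_orbit n)).lintegral_kernel_prod_right'
    rw [← ih, ← hν.lintegral_sum hG]
    refine lintegral_congr fun x => ?_
    rw [S.lintegral_pathKernel x (f := fun ω => g (S.orbit ω x (n + 1)))
      (hg.comp (S.measurable_orbit_right x (n + 1)))]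
    simp only [orbit_prependLetter]

lemma forwardMeasure_apply {B : Set (ℕ → Fin k)} (hB : MeasurableSet B) :
    S.forwardMeasure ν B = ∫⁻ x, S.pathKernel x B ∂ν :=
  Measure.bind_apply hB S.pathKernel.measurable.aemeasurable

lemma isProbabilityMeasure_forwardMeasure [IsProbabilityMeasure ν] :
    IsProbabilityMeasure (S.forwardMeasure ν) :=
  ⟨by simp [forwardMeasure_apply MeasurableSet.univ]⟩

lemma pathKernel_preimage_oneSidedShift (x : X) {B : Set (ℕ → Fin k)} (hB : MeasurableSet B) :
    S.pathKernel x (oneSidedShift ⁻¹' B) =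
      ∑ i, ENNReal.ofReal (S.p i x) * S.pathKernel (S.h i x) B := by
  rw [← lintegral_indicator_one (measurable_oneSidedShift hB),
    S.lintegral_pathKernel x (measurable_one.indicator (measurable_oneSidedShift hB))]
  refine Finset.sum_congr rfl fun i _ => ?_
  rw [← lintegral_indicator_one hB]
  rfl

lemma IsInvariantMeasure.measurePreserving_oneSidedShift (hν : S.IsInvariantMeasure ν) :
    MeasurePreserving oneSidedShift (S.forwardMeasure ν) (S.forwardMeasure ν) := by
  refine ⟨measurable_oneSidedShift, Measure.ext fun B hB => ?_⟩
  rw [Measure.map_apply measurable_oneSidedShift hB,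
    forwardMeasure_apply (measurable_oneSidedShift hB), forwardMeasure_apply hB]
  simp only [pathKernel_preimage_oneSidedShift _ hB]
  exact hν.lintegral_sum (S.pathKernel.measurable_coe hB)

end IFS

/-! ### Contraction on average of a power of the distance, and the Dini condition -/

/-- Expand `∑ p r^q = 1 + q ∑ p log r + O(q²)`. The error is uniform only for bounded logarithms, so
these are truncated below at `-M`; this keeps the drift at most `-b` because each weight is at least
`ε`. -/
lemma exists_sum_mul_rpow_le (ι : Type*) [Fintype ι] {ε b K : ℝ} (hε : 0 < ε) (hb : 0 < b)
    (hK : 1 ≤ K) :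
    ∃ q ρ : ℝ, 0 < q ∧ 0 < ρ ∧ ρ < 1 ∧ ∀ p r : ι → ℝ, (∀ i, ε ≤ p i) → ∑ i, p i = 1 →
      (∀ i, 0 ≤ r i) → (∀ i, r i ≤ K) →
      ((∃ i, r i = 0) ∨ ∑ i, p i * Real.log (r i) < -b) → ∑ i, p i * r i ^ q ≤ ρ := by
  set L := Real.log K with hL
  have hL0 : 0 ≤ L := Real.log_nonneg hK
  -- Chosen so that one truncated coordinate, of weight at least `ε`, outweighs all others, which
  -- are at most `L`.
  set M := (L + b) / ε with hM
  have hM0 : 0 < M := by positivity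
  set N := M + L with hN
  have hN0 : 0 < N := by positivity
  -- The first bound permits `exp u ≤ 1 + u + u²` at `u = q * s i`; the second makes the quadratic
  -- term at most half of the gain `q * b`.
  set q := min (1 / N) (b / (2 * N ^ 2)) with hq
  have hq0 : 0 < q := by positivity
  have hqN : q * N ≤ 1 := by
    have := min_le_left (1 / N) (b / (2 * N ^ 2))
    rwa [← hq, le_div_iff₀ hN0] at this
  have hqN2 : q * (2 * N ^ 2) ≤ b := by
    have := min_le_right (1 / N) (b / (2 * N ^ 2))
    rwa [← hq, le_div_iff₀ (by positivity)] at this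
  refine ⟨q, max (1 / 2) (1 - q * b / 2), hq0, by positivity,
    max_lt (by norm_num) (by linarith [mul_pos hq0 hb]), fun p r hp hsum hr hrK hlog => ?_⟩
  refine le_trans ?_ (le_max_right _ _)
  -- The case `r i = 0` is separate because `Real.log 0 = 0`, whereas `-∞` is meant.
  set s : ι → ℝ := fun i => if r i = 0 then -M else max (Real.log (r i)) (-M) with hs
  have hp0 : ∀ i, 0 ≤ p i := fun i => hε.le.trans (hp i)
  have hsL : ∀ i, s i ≤ L := by
    intro i
    simp only [hs]
    split_ifs with h
    · linarith
    · exact max_le (Real.log_le_log ((hr i).lt_of_ne' h) (hrK i)) (by linarith)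
  have hsM : ∀ i, -M ≤ s i := by
    intro i
    simp only [hs]
    split_ifs with h
    · exact le_rfl
    · exact le_max_right _ _
  have hrs : ∀ i, r i ^ q ≤ Real.exp (q * s i) := by
    intro i
    simp only [hs]
    split_ifs with h
    · rw [h, Real.zero_rpow hq0.ne']
      positivity
    · rw [Real.rpow_def_of_pos ((hr i).lt_of_ne' h), mul_comm]
      gcongr
      exact le_max_left _ _
  have hdrift : ∑ i, p i * s i ≤ -b := by
    by_cases h : ∃ i, s i = -M
    · obtain ⟨i, hi⟩ := h
      have h1 : ∑ j, p j * (L - s j) = L - ∑ j, p j * s j := by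
        simp only [mul_sub, Finset.sum_sub_distrib, ← Finset.sum_mul, hsum, one_mul]
      have h2 := Finset.single_le_sum (f := fun j => p j * (L - s j))
        (fun j _ => mul_nonneg (hp0 j) (by linarith [hsL j])) (Finset.mem_univ i)
      simp only [h1, hi] at h2
      have h3 : ε * (L + M) ≤ p i * (L - -M) := by
        rw [sub_neg_eq_add]
        exact mul_le_mul_of_nonneg_right (hp i) (by linarith)
      have h4 : ε * M = L + b := by rw [hM]; field_simp
      nlinarith [mul_nonneg hε.le hL0]
    · push Not at h
      have h0 : ∀ i, r i ≠ 0 := fun i hi => h i (by simp [hs, hi])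
      have h1 : ∀ i, s i = Real.log (r i) := by
        intro i
        have h2 := h i
        simp only [hs, h0 i, if_false] at h2 ⊢
        rcases max_choice (Real.log (r i)) (-M) with h3 | h3
        · exact h3
        · exact absurd h3 h2
      simp only [h1]
      rcases hlog with ⟨i, hi⟩ | hlog
      · exact absurd hi (h0 i)
      · exact hlog.le
  have hexp : ∀ i, Real.exp (q * s i) ≤ 1 + q * s i + q ^ 2 * N ^ 2 := by
    intro i
    have habs : |s i| ≤ N := abs_le.2 ⟨by linarith [hsM i], by linarith [hsL i]⟩
    have h1 : |q * s i| ≤ 1 := by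
      rw [abs_mul, abs_of_pos hq0]
      exact (mul_le_mul_of_nonneg_left habs hq0.le).trans hqN
    have h2 := (abs_le.1 (Real.abs_exp_sub_one_sub_id_le h1)).2
    have h3 : (q * s i) ^ 2 ≤ q ^ 2 * N ^ 2 := by
      rw [mul_pow, ← sq_abs (s i)]
      gcongr
    linarith
  calc ∑ i, p i * r i ^ q ≤ ∑ i, p i * (1 + q * s i + q ^ 2 * N ^ 2) :=
        Finset.sum_le_sum fun i _ => mul_le_mul_of_nonneg_left ((hrs i).trans (hexp i)) (hp0 i)
    _ = 1 + q * ∑ i, p i * s i + q ^ 2 * N ^ 2 := by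
        rw [Finset.mul_sum]
        simp only [mul_add, Finset.sum_add_distrib, ← Finset.sum_mul, hsum, mul_one, one_mul]
        congr 2
        exact Finset.sum_congr rfl fun i _ => by ring
    _ ≤ 1 - q * b / 2 := by nlinarith

lemma EReal.coe_sum_real {ι : Type*} (s : Finset ι) (f : ι → ℝ) :
    ((∑ i ∈ s, f i : ℝ) : EReal) = ∑ i ∈ s, (f i : EReal) := by
  classical
  induction s using Finset.induction_on with
  | empty => simp
  | insert i s hi ih => rw [Finset.sum_insert hi, Finset.sum_insert hi, EReal.coe_add, ih]

lemma modulusOfContinuity_mono {X : Type*} [MetricSpace X] (f : X → ℝ) :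
    Monotone (modulusOfContinuity f) := fun _ _ h =>
  iSup_mono fun _ => iSup_mono fun _ => iSup_mono' fun hd => ⟨hd.trans h, le_rfl⟩

lemma ofReal_abs_sub_le_modulusOfContinuity {X : Type*} [MetricSpace X] (f : X → ℝ) {x y : X}
    {t : ℝ} (h : dist x y ≤ t) : ENNReal.ofReal |f x - f y| ≤ modulusOfContinuity f t :=
  le_iSup₂_of_le x y (le_iSup_of_le h le_rfl)

/-- The Dini condition makes the modulus of continuity summable along geometric sequences. -/
lemma DiniCondition.tsum_modulusOfContinuity_ne_top {X : Type*} [MetricSpace X] {f : X → ℝ}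
    (hf : DiniCondition f) (hb : ∀ x y, |f x - f y| ≤ 1) {θ : ℝ} (hθ : 0 < θ) (hθ1 : θ < 1) :
    ∑' n : ℕ, modulusOfContinuity f (θ ^ n) ≠ ∞ := by
  obtain ⟨δ, hδ, hint⟩ := hf
  obtain ⟨N, hN⟩ := exists_pow_lt_of_lt_one hδ hθ1
  have hanti : Antitone fun n : ℕ => θ ^ (n + N) := fun m n h =>
    pow_le_pow_of_le_one hθ.le hθ1.le (by omega)
  have hle1 : ∀ t, modulusOfContinuity f t ≤ 1 := fun t =>
    iSup_le fun x => iSup_le fun y => iSup_le fun _ => ENNReal.ofReal_le_one.2 (hb x y)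
  have htail : ∑' n : ℕ, modulusOfContinuity f (θ ^ (n + (N + 1))) ≠ ∞ := by
    -- The interval has length `(1 - θ) * θ ^ (n + N)`, and by monotonicity the integrand is at
    -- least its numerator at the left end over its denominator at the right end.
    have hstep : ∀ n : ℕ, modulusOfContinuity f (θ ^ (n + (N + 1))) * ENNReal.ofReal (1 - θ) ≤
        ∫⁻ t in Ioc (θ ^ (n + 1 + N)) (θ ^ (n + N)),
          modulusOfContinuity f t / ENNReal.ofReal t := by
      intro n
      have hpos : 0 < θ ^ (n + N) := by positivity
      calc modulusOfContinuity f (θ ^ (n + (N + 1))) * ENNReal.ofReal (1 - θ)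
          = ∫⁻ _ in Ioc (θ ^ (n + 1 + N)) (θ ^ (n + N)),
            modulusOfContinuity f (θ ^ (n + 1 + N)) / ENNReal.ofReal (θ ^ (n + N)) := by
            rw [setLIntegral_const, Real.volume_Ioc, div_eq_mul_inv, mul_assoc,
              ← ENNReal.ofReal_inv_of_pos hpos, ← ENNReal.ofReal_mul (by positivity),
              show n + (N + 1) = n + 1 + N by ring]
            congr 2
            rw [show θ ^ (n + 1 + N) = θ ^ (n + N) * θ by ring]
            field_simp
        _ ≤ _ := by
            refine setLIntegral_mono' measurableSet_Ioc fun t ht => ?_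
            exact ENNReal.div_le_div (modulusOfContinuity_mono f ht.1.le)
              (ENNReal.ofReal_le_ofReal ht.2)
    have hsum : (∑' n : ℕ, modulusOfContinuity f (θ ^ (n + (N + 1)))) * ENNReal.ofReal (1 - θ) ≤
        ∫⁻ t in Ioo 0 δ, modulusOfContinuity f t / ENNReal.ofReal t := by
      rw [← ENNReal.tsum_mul_right]
      refine (ENNReal.tsum_le_tsum hstep).trans ?_
      have hdisj : Pairwise (Function.onFun Disjoint
          fun n : ℕ => Ioc (θ ^ (n + 1 + N)) (θ ^ (n + N))) := hanti.pairwise_disjoint_on_Ioc_succ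
      rw [← lintegral_iUnion (fun _ => measurableSet_Ioc) hdisj]
      refine lintegral_mono_set (iUnion_subset fun n t ht => ⟨?_, ?_⟩)
      · exact lt_of_lt_of_le (by positivity) ht.1.le
      · refine (ht.2.trans ?_).trans_lt hN
        exact pow_le_pow_of_le_one hθ.le hθ1.le (by omega)
    intro htop
    rw [htop, ENNReal.top_mul (by simpa using hθ1)] at hsum
    exact (hsum.trans_lt hint).ne rfl
  rw [← ENNReal.summable.sum_add_tsum_nat_add' (k := N + 1)]
  exact ENNReal.add_ne_top.2 ⟨ENNReal.sum_ne_top.2 fun i _ =>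
    ne_top_of_le_ne_top ENNReal.one_ne_top (hle1 _), htail⟩

namespace IFS

variable {X : Type*} [MetricSpace X] [MeasurableSpace X] {k : ℕ} {S : IFS X k}

lemma p_le_one {X : Type*} [MeasurableSpace X] {k : ℕ} (S : IFS X k) (i : Fin k) (x : X) :
    S.p i x ≤ 1 := by
  rw [← S.sum_p x]
  exact Finset.single_le_sum (f := fun i => S.p i x) (fun i _ => S.p_nonneg i x)
    (Finset.mem_univ i)

/-- Contraction on average makes a power of the distance contract in mean. -/
lemma ContractingOnAverage.exists_sum_dist_rpow_le (hcontr : S.ContractingOnAverage)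
    (hlip : ∀ i, ∃ K : ℝ≥0, LipschitzWith K (S.h i))
    (hpos : ∃ ε : ℝ, 0 < ε ∧ ∀ i x, ε ≤ S.p i x) :
    ∃ q ρ : ℝ, 0 < q ∧ 0 < ρ ∧ ρ < 1 ∧ ∀ x y : X,
      ∑ i, S.p i x * dist (S.h i x) (S.h i y) ^ q ≤ ρ * dist x y ^ q := by
  obtain ⟨b, hb, hcontr⟩ := hcontr
  obtain ⟨ε, hε, hp⟩ := hpos
  choose K hK using hlip
  obtain ⟨q, ρ, hq, hρ, hρ1, key⟩ := exists_sum_mul_rpow_le (Fin k) hε hb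
    (K := 1 + ∑ i, (K i : ℝ)) (by linarith [Finset.sum_nonneg fun i (_ : i ∈ Finset.univ) =>
      (K i).coe_nonneg])
  refine ⟨q, ρ, hq, hρ, hρ1, fun x y => ?_⟩
  rcases eq_or_ne x y with rfl | hxy
  · simp [Real.zero_rpow hq.ne']
  have hd : 0 < dist x y := dist_pos.2 hxy
  have h := key (fun i => S.p i x) (fun i => dist (S.h i x) (S.h i y) / dist x y)
    (fun i => hp i x) (S.sum_p x) (fun i => by positivity) (fun i => ?_) ?_
  · have h1 : ∀ i, S.p i x * dist (S.h i x) (S.h i y) ^ q =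
        S.p i x * (dist (S.h i x) (S.h i y) / dist x y) ^ q * dist x y ^ q := by
      intro i
      rw [Real.div_rpow dist_nonneg dist_nonneg, mul_assoc,
        div_mul_cancel₀ _ (Real.rpow_pos_of_pos hd q).ne']
    simp only [h1, ← Finset.sum_mul]
    exact mul_le_mul_of_nonneg_right h (by positivity)
  · rw [div_le_iff₀ hd]
    refine ((hK i).dist_le_mul x y).trans (mul_le_mul_of_nonneg_right ?_ hd.le)
    have := Finset.single_le_sum (f := fun i => (K i : ℝ)) (fun i _ => (K i).coe_nonneg)
      (Finset.mem_univ i)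
    linarith
  · by_cases h0 : ∃ i, dist (S.h i x) (S.h i y) / dist x y = 0
    · exact .inl h0
    · right
      push Not at h0
      have h1 : ∀ i, (S.p i x : EReal) *
          ENNReal.log (edist (S.h i x) (S.h i y) / edist x y) =
          ((S.p i x * Real.log (dist (S.h i x) (S.h i y) / dist x y) : ℝ) : EReal) := by
        intro i
        rw [edist_dist, edist_dist, ← ENNReal.ofReal_div_of_pos hd,
          ENNReal.log_ofReal_of_pos ((h0 i).symm.lt_of_le (by positivity)), EReal.coe_mul]
      have h2 := hcontr x y hxy
      simp only [h1] at h2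
      rw [← EReal.coe_sum_real] at h2
      exact_mod_cast h2

end IFS

/-! ### The path measures of two points are not mutually singular -/

namespace IFS

section LikelihoodRatio

variable {X : Type*} [MeasurableSpace X] {k : ℕ} {S : IFS X k}

/-- The total variation of the probabilities along the orbits of `x` and `y` under the first `n`
letters of `ω`. -/
noncomputable def orbitVariation (S : IFS X k) (x y : X) (n : ℕ) (ω : ℕ → Fin k) : ℝ :=
  ∑ i ∈ Finset.range n, |S.p (ω i) (S.orbit ω x i) - S.p (ω i) (S.orbit ω y i)|

lemma measurable_p_orbit (S : IFS X k) (x : X) (i : ℕ) :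
    Measurable fun ω : ℕ → Fin k => S.p (ω i) (S.orbit ω x i) := by
  have h : Measurable fun z : X × Fin k => S.p z.2 z.1 :=
    measurable_from_prod_countable_left S.measurable_p
  exact h.comp ((S.measurable_orbit_right x i).prodMk (measurable_pi_apply i))

lemma measurable_abs_sub_p_orbit (S : IFS X k) (x y : X) (i : ℕ) :
    Measurable fun ω : ℕ → Fin k =>
      |S.p (ω i) (S.orbit ω x i) - S.p (ω i) (S.orbit ω y i)| :=
  ((S.measurable_p_orbit x i).sub (S.measurable_p_orbit y i)).abs

lemma measurable_orbitVariation (S : IFS X k) (x y : X) (n : ℕ) :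
    Measurable (S.orbitVariation x y n) :=
  Finset.measurable_fun_sum _ fun i _ => S.measurable_abs_sub_p_orbit x y i

lemma abs_sub_p_le_one (S : IFS X k) (i : Fin k)
    (x y : X) : |S.p i x - S.p i y| ≤ 1 :=
  abs_le.2 ⟨by linarith [S.p_nonneg i x, S.p_le_one i y],
    by linarith [S.p_nonneg i y, S.p_le_one i x]⟩

/-- The likelihood ratio of the path measures of `y` and `x` on the first `n` letters. -/
lemma lintegral_pathKernel_eq_lintegral_mul_prod (hp : ∀ i x, 0 < S.p i x) {n : ℕ}
    {f : (ℕ → Fin k) → ℝ≥0∞} (hf : Measurable f)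
    (hfn : DependsOn f (Iio n)) (x y : X) :
    ∫⁻ ω, f ω ∂(S.pathKernel y) =
      ∫⁻ ω, f ω * ENNReal.ofReal (∏ i ∈ Finset.range n,
        (S.p (ω i) (S.orbit ω y i) / S.p (ω i) (S.orbit ω x i))) ∂(S.pathKernel x) := by
  have hm : ∀ (n : ℕ) (x y : X), Measurable fun ω : ℕ → Fin k => ENNReal.ofReal
      (∏ i ∈ Finset.range n, (S.p (ω i) (S.orbit ω y i) / S.p (ω i) (S.orbit ω x i))) :=
    fun n x y => (Finset.measurable_fun_prod _ fun i _ =>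
      (S.measurable_p_orbit y i).div (S.measurable_p_orbit x i)).ennreal_ofReal
  induction n generalizing f x y with
  | zero =>
    obtain hk | hk := isEmpty_or_nonempty (ℕ → Fin k)
    · have h1 := (S.pathKernel x).eq_zero_of_isEmpty
      have h2 := (S.pathKernel y).eq_zero_of_isEmpty
      simp [h1, h2]
    · obtain ⟨ω₀⟩ := hk
      have hc : ∀ ω, f ω = f ω₀ := fun ω => hfn fun i hi => absurd hi (by simp)
      simp [hc]
  | succ n ih =>
    rw [S.lintegral_pathKernel y hf,
      S.lintegral_pathKernel x (f := fun ω => f ω * ENNReal.ofReal (∏ i ∈ Finset.range (n + 1),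
        (S.p (ω i) (S.orbit ω y i) / S.p (ω i) (S.orbit ω x i)))) (hf.mul (hm _ _ _))]
    refine Finset.sum_congr rfl fun i _ => ?_
    have hfi : Measurable fun ω => f (prependLetter i ω) := hf.comp (measurable_prependLetter i)
    rw [ih hfi (dependsOn_prependLetter hfn i) (S.h i x) (S.h i y)]
    have e : ∀ ω : ℕ → Fin k, f (prependLetter i ω) * ENNReal.ofReal
        (∏ j ∈ Finset.range (n + 1), (S.p (prependLetter i ω j) (S.orbit (prependLetter i ω) y j) /
          S.p (prependLetter i ω j) (S.orbit (prependLetter i ω) x j))) =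
        f (prependLetter i ω) * ENNReal.ofReal (∏ j ∈ Finset.range n,
          (S.p (ω j) (S.orbit ω (S.h i y) j) / S.p (ω j) (S.orbit ω (S.h i x) j))) *
          ENNReal.ofReal (S.p i y / S.p i x) := by
      intro ω
      rw [Finset.prod_range_succ', ENNReal.ofReal_mul
        (Finset.prod_nonneg fun j _ => div_nonneg (S.p_nonneg _ _) (S.p_nonneg _ _)), ← mul_assoc]
      simp only [orbit_prependLetter]
      rfl
    simp only [e]
    rw [lintegral_mul_const' _ _ ENNReal.ofReal_ne_top, mul_comm (lintegral _ _), ← mul_assoc,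
      ← ENNReal.ofReal_mul (S.p_nonneg _ _), mul_div_cancel₀ _ (hp i x).ne']

/-- Bounds one factor of the likelihood ratio, from `a / b ≤ 1 + |a - b| / ε ≤ exp (|a - b| / ε)`.
-/
lemma exp_neg_abs_sub_div_le {ε a b : ℝ} (hε : 0 < ε) (ha : ε ≤ a) (hb : ε ≤ b) :
    Real.exp (-(|a - b| / ε)) ≤ b / a := by
  have ha0 := hε.trans_le ha
  have hb0 := hε.trans_le hb
  rw [Real.exp_neg, inv_le_comm₀ (Real.exp_pos _) (by positivity), inv_div]
  calc a / b = (a - b) / b + 1 := by field_simp; ring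
    _ ≤ |a - b| / ε + 1 := by
        gcongr
        exact le_abs_self _
    _ ≤ _ := Real.add_one_le_exp _

lemma exp_neg_orbitVariation_le {ε : ℝ} (hε : 0 < ε) (hp : ∀ i x, ε ≤ S.p i x) (x y : X) (n : ℕ)
    (ω : ℕ → Fin k) :
    Real.exp (-(S.orbitVariation x y n ω / ε)) ≤
      ∏ i ∈ Finset.range n, (S.p (ω i) (S.orbit ω y i) / S.p (ω i) (S.orbit ω x i)) := by
  rw [orbitVariation, Finset.sum_div, ← Finset.sum_neg_distrib, Real.exp_sum]
  exact Finset.prod_le_prod (fun _ _ => (Real.exp_pos _).le) fun i _ =>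
    exp_neg_abs_sub_div_le hε (hp _ _) (hp _ _)

lemma exists_dependsOn_mem {A : Type*} [MeasurableSpace A] {C : Set (ℕ → A)}
    (hC : C ∈ measurableCylinders fun _ : ℕ => A) :
    ∃ n, ∀ c : ℝ≥0∞, DependsOn (C.indicator fun _ => c) (Iio n) := by
  obtain ⟨s, T, -, rfl⟩ := (mem_measurableCylinders C).1 hC
  refine ⟨s.sup id + 1, fun c ω ω' h => dependsOn_cylinder_indicator_const T c fun i hi =>
    h i ?_⟩
  exact Nat.lt_succ_of_le (Finset.le_sup (f := id) (Finset.mem_coe.1 hi))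

end LikelihoodRatio

section Singular

variable {X : Type*} [MetricSpace X] [SecondCountableTopology X] [MeasurableSpace X] [BorelSpace X]
  {k : ℕ} {S : IFS X k}

lemma measurable_dist_orbit (S : IFS X k) (x y : X) (n : ℕ) :
    Measurable fun ω : ℕ → Fin k => dist (S.orbit ω x n) (S.orbit ω y n) :=
  (S.measurable_orbit_right x n).dist (S.measurable_orbit_right y n)

/-- Both orbits follow letters drawn along the orbit of `x`. The weights in `hcontr` are also those
of the first point, so the contraction iterates. -/
lemma lintegral_dist_orbit_rpow_le {q ρ : ℝ} (hρ : 0 < ρ)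
    (hcontr : ∀ x y : X, ∑ i, S.p i x * dist (S.h i x) (S.h i y) ^ q ≤ ρ * dist x y ^ q)
    (x y : X) (n : ℕ) :
    ∫⁻ ω, ENNReal.ofReal (dist (S.orbit ω x n) (S.orbit ω y n) ^ q) ∂(S.pathKernel x) ≤
      ENNReal.ofReal (ρ ^ n * dist x y ^ q) := by
  induction n generalizing x y with
  | zero => simp [orbit]
  | succ n ih =>
    rw [S.lintegral_pathKernel x
      (f := fun ω => ENNReal.ofReal (dist (S.orbit ω x (n + 1)) (S.orbit ω y (n + 1)) ^ q))
      ((S.measurable_dist_orbit x y (n + 1)).pow_const q).ennreal_ofReal]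
    simp only [orbit_prependLetter]
    calc _ ≤ ∑ i, ENNReal.ofReal (S.p i x) *
          ENNReal.ofReal (ρ ^ n * dist (S.h i x) (S.h i y) ^ q) :=
          Finset.sum_le_sum fun i _ => mul_le_mul_right (ih _ _) _
      _ = ENNReal.ofReal (ρ ^ n * ∑ i, S.p i x * dist (S.h i x) (S.h i y) ^ q) := by
          rw [Finset.mul_sum, ENNReal.ofReal_sum_of_nonneg fun i _ =>
            mul_nonneg (by positivity) (mul_nonneg (S.p_nonneg i x) (by positivity))]
          refine Finset.sum_congr rfl fun i _ => ?_
          rw [← ENNReal.ofReal_mul (S.p_nonneg i x)]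
          congr 1
          ring
      _ ≤ _ := by
          refine ENNReal.ofReal_le_ofReal ?_
          rw [pow_succ, mul_assoc]
          exact mul_le_mul_of_nonneg_left (hcontr x y) (by positivity)

/-- At time `i`, either the orbits are within `θ ^ i`, and the increment is bounded by moduli of
continuity summable by the Dini condition, or they are not, which by Markov's inequality has
geometrically small probability. -/
lemma exists_lintegral_orbitVariation_le (hdini : ∀ i, DiniCondition (S.p i)) {q ρ : ℝ}
    (hq : 0 < q) (hρ : 0 < ρ) (hρ1 : ρ < 1)
    (hcontr : ∀ x y : X, ∑ i, S.p i x * dist (S.h i x) (S.h i y) ^ q ≤ ρ * dist x y ^ q)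
    (x y : X) :
    ∃ M : ℝ≥0∞, M ≠ ∞ ∧ ∀ n,
      ∫⁻ ω, ENNReal.ofReal (S.orbitVariation x y n ω) ∂(S.pathKernel x) ≤ M := by
  -- With `θ ^ q = √ρ`, dividing the mean `ρ ^ i * D` by the threshold `θ ^ (i * q)` still leaves
  -- the summable `√ρ ^ i * D`.
  set θ : ℝ := ρ ^ (1 / (2 * q)) with hθ
  have hθ0 : 0 < θ := Real.rpow_pos_of_pos hρ _
  have hθ1 : θ < 1 := Real.rpow_lt_one hρ.le hρ1 (by positivity)
  have hθq : θ ^ q = Real.sqrt ρ := by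
    rw [hθ, ← Real.rpow_mul hρ.le, Real.sqrt_eq_rpow]
    congr 1
    field_simp
  have hs0 : 0 < Real.sqrt ρ := Real.sqrt_pos.2 hρ
  have hs1 : Real.sqrt ρ < 1 := by rw [Real.sqrt_lt' one_pos]; simpa using hρ1
  set Φ : ℕ → ℝ≥0∞ := fun i => ∑ j, modulusOfContinuity (S.p j) (θ ^ i) with hΦ
  set D : ℝ := dist x y ^ q with hD
  have hD0 : 0 ≤ D := by positivity
  have hptw : ∀ (i : ℕ) (ω : ℕ → Fin k),
      ENNReal.ofReal |S.p (ω i) (S.orbit ω x i) - S.p (ω i) (S.orbit ω y i)| ≤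
        Φ i + ENNReal.ofReal (dist (S.orbit ω x i) (S.orbit ω y i) ^ q) *
          ENNReal.ofReal ((Real.sqrt ρ ^ i)⁻¹) := by
    intro i ω
    rcases le_or_gt (dist (S.orbit ω x i) (S.orbit ω y i)) (θ ^ i) with h | h
    · refine le_add_right ((ofReal_abs_sub_le_modulusOfContinuity (S.p (ω i)) h).trans ?_)
      exact Finset.single_le_sum (f := fun j => modulusOfContinuity (S.p j) (θ ^ i))
        (fun _ _ => zero_le) (Finset.mem_univ (ω i))
    · refine le_add_left ?_
      rw [← ENNReal.ofReal_mul (by positivity)]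
      refine ENNReal.ofReal_le_ofReal ((S.abs_sub_p_le_one _ _ _).trans ?_)
      rw [← div_eq_mul_inv, one_le_div (by positivity), ← hθq, ← Real.rpow_natCast,
        ← Real.rpow_mul hθ0.le, mul_comm, Real.rpow_mul hθ0.le, Real.rpow_natCast]
      exact Real.rpow_le_rpow (by positivity) h.le hq.le
  have hterm : ∀ i : ℕ,
      ∫⁻ ω, ENNReal.ofReal |S.p (ω i) (S.orbit ω x i) - S.p (ω i) (S.orbit ω y i)|
        ∂(S.pathKernel x) ≤ Φ i + ENNReal.ofReal (Real.sqrt ρ ^ i * D) := by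
    intro i
    have hm := ((S.measurable_dist_orbit x y i).pow_const q).ennreal_ofReal
    refine (lintegral_mono (hptw i)).trans ?_
    rw [lintegral_add_left measurable_const, lintegral_const, measure_univ, mul_one,
      lintegral_mul_const _ hm]
    gcongr
    refine (mul_le_mul_left (lintegral_dist_orbit_rpow_le hρ hcontr x y i) _).trans_eq ?_
    rw [← ENNReal.ofReal_mul (by positivity)]
    congr 1
    have hss : ρ ^ i = Real.sqrt ρ ^ i * Real.sqrt ρ ^ i := by
      rw [← mul_pow, Real.mul_self_sqrt hρ.le]
    have := (pow_pos hs0 i).ne'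
    rw [hss, ← hD]
    field_simp
  refine ⟨∑' i, Φ i + ∑' i : ℕ, ENNReal.ofReal (Real.sqrt ρ ^ i * D), ?_, fun n => ?_⟩
  · refine ENNReal.add_ne_top.2 ⟨?_, ?_⟩
    · rw [hΦ, Summable.tsum_finsetSum fun _ _ => ENNReal.summable]
      exact ENNReal.sum_ne_top.2 fun j _ =>
        (hdini j).tsum_modulusOfContinuity_ne_top (S.abs_sub_p_le_one j) hθ0 hθ1
    · rw [← ENNReal.ofReal_tsum_of_nonneg (fun _ => by positivity)
        ((summable_geometric_of_lt_one hs0.le hs1).mul_right D)]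
      exact ENNReal.ofReal_ne_top
  · simp only [orbitVariation]
    calc _ = ∑ i ∈ Finset.range n,
          ∫⁻ ω, ENNReal.ofReal |S.p (ω i) (S.orbit ω x i) - S.p (ω i) (S.orbit ω y i)|
            ∂(S.pathKernel x) := by
          rw [← lintegral_finsetSum _ fun i _ =>
            (S.measurable_abs_sub_p_orbit x y i).ennreal_ofReal]
          exact lintegral_congr fun ω => ENNReal.ofReal_sum_of_nonneg fun _ _ => abs_nonneg _
      _ ≤ ∑ i ∈ Finset.range n, (Φ i + ENNReal.ofReal (Real.sqrt ρ ^ i * D)) :=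
          Finset.sum_le_sum fun i _ => hterm i
      _ ≤ _ := by
          rw [← ENNReal.tsum_add]
          exact ENNReal.sum_le_tsum _

/-- The path measures of two points are not mutually singular. -/
theorem pathKernel_ne_zero_or (hdini : ∀ i, DiniCondition (S.p i))
    (hlip : ∀ i, ∃ K : ℝ≥0, LipschitzWith K (S.h i))
    (hpos : ∃ ε : ℝ, 0 < ε ∧ ∀ i x, ε ≤ S.p i x)
    (hcontr : S.ContractingOnAverage) (x y : X) {B : Set (ℕ → Fin k)} (hB : MeasurableSet B) :
    S.pathKernel x B ≠ 0 ∨ S.pathKernel y Bᶜ ≠ 0 := by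
  by_contra hne
  push Not at hne
  obtain ⟨hx, hy⟩ := hne
  obtain ⟨q, ρ, hq, hρ, hρ1, hc⟩ := hcontr.exists_sum_dist_rpow_le hlip hpos
  obtain ⟨ε, hε, hp⟩ := hpos
  obtain ⟨M', hM', hint⟩ := exists_lintegral_orbitVariation_le hdini hq hρ hρ1 hc x y
  set M : ℝ := M'.toReal + 1 with hM
  have hM0 : 0 < M := by positivity
  have hM'M : M' ≤ ENNReal.ofReal M := by
    rw [← ENNReal.ofReal_toReal hM']
    exact ENNReal.ofReal_le_ofReal (by linarith)
  set c : ℝ := Real.exp (-(2 * M / ε)) with hcdef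
  have hc0 : 0 < c := Real.exp_pos _
  have hc1 : c ≤ 1 := Real.exp_le_one_iff.2 (by rw [neg_nonpos]; positivity)
  -- The likelihood ratio is available only on finitely many letters, so `B` is replaced by a
  -- cylinder close to it for both measures; `c` does not depend on its length.
  obtain ⟨C, hC, hlt⟩ := exists_measurableCylinders_symmDiff_lt
    (S.pathKernel x + S.pathKernel y) hB (show 0 < c / 8 by positivity)
  have hCc := compl_mem_measurableCylinders hC
  obtain ⟨n, hn⟩ := exists_dependsOn_mem hCc
  have hCm : MeasurableSet C := MeasurableSet.of_mem_measurableCylinders hC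
  rw [Measure.add_apply] at hlt
  have hxC : (S.pathKernel x).real C ≤ c / 8 := by
    refine ENNReal.toReal_le_of_le_ofReal (by positivity) ?_
    calc S.pathKernel x C ≤ S.pathKernel x (B ∪ B ∆ C) := measure_mono fun ω hω => by
          by_cases h : ω ∈ B
          · exact .inl h
          · exact .inr (.inr ⟨hω, h⟩)
      _ ≤ S.pathKernel x B + S.pathKernel x (B ∆ C) := measure_union_le _ _
      _ ≤ _ := by
        rw [hx, zero_add]
        exact le_self_add.trans hlt.le
  have hyC : (S.pathKernel y).real Cᶜ ≤ c / 8 := by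
    refine ENNReal.toReal_le_of_le_ofReal (by positivity) ?_
    calc S.pathKernel y Cᶜ ≤ S.pathKernel y (Bᶜ ∪ B ∆ C) := measure_mono fun ω hω => by
          by_cases h : ω ∈ B
          · exact .inr (.inl ⟨h, hω⟩)
          · exact .inl h
      _ ≤ S.pathKernel y Bᶜ + S.pathKernel y (B ∆ C) := measure_union_le _ _
      _ ≤ _ := by
        rw [hy, zero_add]
        exact le_add_self.trans hlt.le
  -- On `G` the likelihood ratio is at least `c`; Markov's inequality gives its complement mass at
  -- most `1 / 2`.
  set G : Set (ℕ → Fin k) := {ω | S.orbitVariation x y n ω < 2 * M} with hG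
  have hGm : MeasurableSet G := measurableSet_lt (S.measurable_orbitVariation x y n)
    measurable_const
  have hxG : (S.pathKernel x).real Gᶜ ≤ 1 / 2 := by
    refine ENNReal.toReal_le_of_le_ofReal (by norm_num) ?_
    have h1 := mul_meas_ge_le_lintegral (μ := S.pathKernel x)
      (S.measurable_orbitVariation x y n).ennreal_ofReal (ENNReal.ofReal (2 * M))
    have h2 : Gᶜ ⊆ {ω | ENNReal.ofReal (2 * M) ≤ ENNReal.ofReal (S.orbitVariation x y n ω)} :=
      fun ω hω => ENNReal.ofReal_le_ofReal (not_lt.1 hω)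
    have h3 : ENNReal.ofReal (2 * M) * S.pathKernel x Gᶜ ≤ ENNReal.ofReal M :=
      (mul_le_mul_right (measure_mono h2) _).trans (h1.trans ((hint n).trans hM'M))
    rw [ENNReal.mul_le_iff_le_inv (by simpa using hM0) ENNReal.ofReal_ne_top,
      ← ENNReal.ofReal_inv_of_pos (by positivity), ← ENNReal.ofReal_mul (by positivity)] at h3
    refine h3.trans_eq ?_
    congr 1
    field_simp
  have hlow : c * (S.pathKernel x).real (Cᶜ ∩ G) ≤ (S.pathKernel y).real Cᶜ := by
    have h1 : ENNReal.ofReal c * S.pathKernel x (Cᶜ ∩ G) ≤ S.pathKernel y Cᶜ := by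
      rw [← lintegral_indicator_const (hCm.compl.inter hGm), ← lintegral_indicator_one hCm.compl,
        lintegral_pathKernel_eq_lintegral_mul_prod (fun i x => hε.trans_le (hp i x))
          (measurable_one.indicator hCm.compl) (hn 1) x y]
      refine lintegral_mono fun ω => ?_
      by_cases h : ω ∈ Cᶜ ∩ G
      · rw [indicator_of_mem h, indicator_of_mem h.1, Pi.one_apply, one_mul]
        refine ENNReal.ofReal_le_ofReal (le_trans ?_ (exp_neg_orbitVariation_le hε hp x y n ω))
        refine Real.exp_le_exp.2 (neg_le_neg ?_)
        exact div_le_div_of_nonneg_right (le_of_lt h.2) hε.le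
      · rw [indicator_of_notMem h]
        exact zero_le
    have h2 := ENNReal.toReal_mono (measure_ne_top _ _) h1
    rwa [ENNReal.toReal_mul, ENNReal.toReal_ofReal hc0.le] at h2
  have hcover : 1 ≤ (S.pathKernel x).real C + (S.pathKernel x).real Gᶜ +
      (S.pathKernel x).real (Cᶜ ∩ G) := by
    calc 1 = (S.pathKernel x).real univ := by simp
      _ ≤ (S.pathKernel x).real (C ∪ Gᶜ ∪ (Cᶜ ∩ G)) := measureReal_mono fun ω _ => by
          by_cases h1 : ω ∈ C
          · exact .inl (.inl h1)
          · by_cases h2 : ω ∈ G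
            · exact .inr ⟨h1, h2⟩
            · exact .inl (.inr h2)
      _ ≤ _ := (measureReal_union_le _ _).trans (by gcongr; exact measureReal_union_le _ _)
  -- `Cᶜ ∩ G` has `p_x`-mass at least `1/2 - c/8 ≥ 3/8`, so `Cᶜ` has `p_y`-mass at least `3c/8`,
  -- contradicting `hyC`.
  nlinarith

end Singular

end IFS

/-! ### Ergodicity -/

namespace IFS

section Ergodic

variable {X : Type*} [MeasurableSpace X] {k : ℕ} {S : IFS X k} {ν : Measure X}

/-- Given the first `n` letters, a shift-invariant event has the probability that it has for the
current point. -/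
lemma pathKernel_inter_of_invariant {B C : Set (ℕ → Fin k)} (hB : MeasurableSet B)
    (hinv : oneSidedShift ⁻¹' B = B) (hC : MeasurableSet C) {n : ℕ}
    (hn : DependsOn (C.indicator fun _ => (1 : ℝ≥0∞)) (Iio n)) (x : X) :
    S.pathKernel x (C ∩ B) = ∫⁻ ω, C.indicator 1 ω * S.pathKernel (S.orbit ω x n) B
      ∂(S.pathKernel x) := by
  have hit : (oneSidedShift^[n] : (ℕ → Fin k) → ℕ → Fin k) ⁻¹' B = B := by
    clear hn
    induction n with
    | zero => rfl
    | succ n ih => rw [Function.iterate_succ, preimage_comp, ih, hinv]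
  have h := S.lintegral_mul_shift (n := n) (f := C.indicator 1) (g := B.indicator 1)
    (measurable_one.indicator hC) (measurable_one.indicator hB) hn x
  simp only [lintegral_indicator_one hB] at h
  rw [← h, ← lintegral_indicator_one (hC.inter hB)]
  refine lintegral_congr fun ω => ?_
  have h1 : oneSidedShift^[n] ω ∈ B ↔ ω ∈ B := by
    conv_rhs => rw [← hit]
    rfl
  by_cases hωC : ω ∈ C <;> by_cases hωB : ω ∈ B <;> simp [hωC, hωB, h1]

/-- A shift-invariant event has probability `0` or `1` from almost every starting point. -/
lemma IsInvariantMeasure.ae_pathKernel_eq_zero_or (hν : S.IsInvariantMeasure ν)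
    {B : Set (ℕ → Fin k)} (hB : MeasurableSet B) (hinv : oneSidedShift ⁻¹' B = B) :
    ∀ᵐ x ∂ν, S.pathKernel x B = 0 ∨ S.pathKernel x Bᶜ = 0 := by
  have := hν.isProbabilityMeasure
  have := isProbabilityMeasure_forwardMeasure (S := S) (ν := ν)
  have hinv' : oneSidedShift ⁻¹' Bᶜ = Bᶜ := by rw [preimage_compl, hinv]
  have hu := S.pathKernel.measurable_coe hB
  have hv := S.pathKernel.measurable_coe hB.compl
  have hw : Measurable fun x => S.pathKernel x B * S.pathKernel x Bᶜ := hu.mul hv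
  suffices h : ∫⁻ x, S.pathKernel x B * S.pathKernel x Bᶜ ∂ν = 0 by
    rw [lintegral_eq_zero_iff hw] at h
    filter_upwards [h] with x hx
    simpa using hx
  refine le_antisymm (le_of_forall_gt fun δ hδ => ?_) zero_le
  obtain ⟨r, -, hr0, hr⟩ := ENNReal.lt_iff_exists_real_btwn.1 hδ
  obtain ⟨C, hC, hlt⟩ := exists_measurableCylinders_symmDiff_lt (S.forwardMeasure ν) hB
    (ENNReal.ofReal_pos.1 hr0)
  have hCm : MeasurableSet C := MeasurableSet.of_mem_measurableCylinders hC
  obtain ⟨n, hn⟩ := exists_dependsOn_mem hC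
  have hn' : DependsOn (Cᶜ.indicator fun _ => (1 : ℝ≥0∞)) (Iio n) := by
    intro ω ω' h
    have h1 := hn 1 h
    by_cases h2 : ω ∈ C <;> by_cases h3 : ω' ∈ C <;> simp_all
  refine lt_of_le_of_lt ?_ (hlt.trans hr)
  -- Evaluating the product at time `n` rather than `0` costs nothing by stationarity, and by then
  -- the first `n` letters nearly decide `B` through `C`.
  rw [← hν.lintegral_orbit hw n, forwardMeasure_apply (hB.symmDiff hCm)]
  refine lintegral_mono fun x => ?_
  -- By the Markov property the two terms on the right integrate to the probabilities of `C \ B` and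
  -- `B \ C`.
  have hle : ∀ ω : ℕ → Fin k,
      S.pathKernel (S.orbit ω x n) B * S.pathKernel (S.orbit ω x n) Bᶜ ≤
        C.indicator 1 ω * S.pathKernel (S.orbit ω x n) Bᶜ +
          Cᶜ.indicator 1 ω * S.pathKernel (S.orbit ω x n) B := by
    intro ω
    by_cases h : ω ∈ C
    · simpa [h] using mul_le_of_le_one_left' prob_le_one
    · simpa [h] using mul_le_of_le_one_right' prob_le_one
  refine (lintegral_mono hle).trans ?_
  have hm : Measurable fun ω : ℕ → Fin k =>
      C.indicator 1 ω * S.pathKernel (S.orbit ω x n) Bᶜ :=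
    (measurable_one.indicator hCm).mul (hv.comp (S.measurable_orbit_right x n))
  rw [lintegral_add_left hm,
    ← pathKernel_inter_of_invariant hB.compl hinv' hCm (hn 1) x,
    ← pathKernel_inter_of_invariant hB hinv hCm.compl hn' x,
    ← measure_union (disjoint_compl_right.mono inter_subset_left inter_subset_left)
      (hCm.compl.inter hB)]
  refine measure_mono ?_
  rintro ω (⟨h1, h2⟩ | ⟨h1, h2⟩)
  · exact .inr ⟨h1, h2⟩
  · exact .inl ⟨h2, h1⟩

end Ergodic

variable {X : Type*} [MetricSpace X] [SecondCountableTopology X] [MeasurableSpace X] [BorelSpace X]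
  {k : ℕ} {S : IFS X k} {ν : Measure X}

/-- The one-sided shift is ergodic with respect to the forward measure. -/
theorem IsInvariantMeasure.ergodic_oneSidedShift (hν : S.IsInvariantMeasure ν)
    (hdini : ∀ i, DiniCondition (S.p i)) (hlip : ∀ i, ∃ K : ℝ≥0, LipschitzWith K (S.h i))
    (hpos : ∃ ε : ℝ, 0 < ε ∧ ∀ i x, ε ≤ S.p i x) (hcontr : S.ContractingOnAverage) :
    Ergodic oneSidedShift (S.forwardMeasure ν) := by
  refine { hν.measurePreserving_oneSidedShift with aeconst_set := fun B hB hinv => ?_ }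
  have hae := hν.ae_pathKernel_eq_zero_or hB hinv
  rw [eventuallyConst_set', ae_eq_empty, ae_eq_univ, forwardMeasure_apply hB,
    forwardMeasure_apply hB.compl, lintegral_eq_zero_iff (S.pathKernel.measurable_coe hB),
    lintegral_eq_zero_iff (S.pathKernel.measurable_coe hB.compl)]
  have hsing := fun x y => pathKernel_ne_zero_or hdini hlip hpos hcontr x y hB
  -- One point with `p_x(B) = 0` prevents `p_y(Bᶜ) = 0` for every `y`, so the zero-one alternative
  -- takes the same side almost everywhere.
  by_cases h : ∃ x, S.pathKernel x B = 0
  · obtain ⟨x, hx⟩ := h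
    left
    filter_upwards [hae] with y hy
    exact hy.resolve_right ((hsing x y).resolve_left (not_not.2 hx))
  · right
    filter_upwards [hae] with y hy
    exact hy.resolve_left fun hy' => h ⟨y, hy'⟩

end IFS

theorem proposition3 {X : Type*} [MetricSpace X] [CompleteSpace X]
    [TopologicalSpace.SeparableSpace X] [MeasurableSpace X] [BorelSpace X] {k : ℕ}
    (S : IFS X k)
    (hlip : ∀ i, ∃ K : ℝ≥0, LipschitzWith K (S.h i))
    (hdini : ∀ i, DiniCondition (S.p i))
    (hpos : ∃ ε : ℝ, 0 < ε ∧ ∀ i x, ε ≤ S.p i x)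
    (hcontr : S.ContractingOnAverage)
    (ν : Measure X) (hν : S.IsInvariantMeasure ν) :
    ∃ μ : Measure (ℤ → Fin k),
      IsNaturalExtension (S.forwardMeasure ν) μ ∧
      (∀ μ' : Measure (ℤ → Fin k), IsNaturalExtension (S.forwardMeasure ν) μ' → μ' = μ) ∧
      Ergodic twoSidedShift μ := by
  have := UniformSpace.secondCountable_of_separable X
  have := hν.isProbabilityMeasure
  have := IFS.isProbabilityMeasure_forwardMeasure (S := S) (ν := ν)
  have herg := hν.ergodic_oneSidedShift hdini hlip hpos hcontr
  obtain ⟨μ, hμ⟩ := exists_isNaturalExtension herg.toMeasurePreserving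
  exact ⟨μ, hμ, fun _ hμ' => hμ'.eq hμ, hμ.ergodic herg⟩
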